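/- **Theorem (Ky Fan additive inequality).** Let $A$ be a (not necessarily unital) C*-algebra. Write $P(A)$ for the set of projections of $A$ and $P_\infty(A)=\bigsqcup_{n\ge 1}P(M_n(A))$. For $p\in P_\infty(A)$ let $[p]_0$ be its class in $K_0(A)$, and put $$K_0(A)^+=\{[p]_0: p\in P_\infty(A)\},\qquad D_0(A)=\{[p]_0: p\in P(A)\}.$$ Order $K_0(A)$ by $g\le h$ if and only if $h-g\in K_0(A)^+$. For $a\in A$ and $g\in K_0(A)^+$ define the singular value function of $a$ at $g$ by $$s_g(a)=\inf\{\|a-ap\| : p\in P(A),\ [p]_0\le g\}.$$ Assume that 1. $A$ has cancellation: for all $p,q\in P_\infty(A)$, $[p]_0=[q]_0$ if and only if $p$ and $q$ are Murray--von Neumann equivalent, i.e. there is a rectangular matrix $v$ over $A$ with $p=v^*v$ and $q=vv^*$; 2. $A$ is contained in the norm closure of the set of invertible elements of its multiplier algebra $M(A)$; 3. $K_0(A)^+=D_0(A)$. Then $$s_{g+h}(a+b)\le s_g(a)+s_h(b)\qquad\text{for all } a,b\in A \text{ and all } g,h\in K_0(A)^+.$$ -/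

import Mathlib

open scoped Matrix MultiplierAlgebra

namespace SVF

/-! ### Projections in matrix algebras and Murray-von Neumann equivalence -/

section Projections

/-- Murray-von Neumann equivalence of square matrices `a`, `b`, possibly of different sizes:
there is a rectangular matrix `v` with `a = v* v` and `b = v v*`. -/
def MvN {R : Type*} [NonUnitalRing R] [StarRing R] {m n : Type*} [Fintype m] [Fintype n]
    (a : Matrix m m R) (b : Matrix n n R) : Prop :=
  ∃ v : Matrix n m R, vᴴ * v = a ∧ v * vᴴ = b

variable {R : Type*} [NonUnitalRing R] [StarRing R]
variable {k l m n : Type*} [Fintype k] [Fintype l] [Fintype m] [Fintype n]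

theorem MvN.refl {a : Matrix m m R} (ha : IsStarProjection a) : MvN a a := by
  have h1 : aᴴ = a := ha.isSelfAdjoint
  have h2 : a * a = a := ha.isIdempotentElem
  exact ⟨a, by rw [h1, h2], by rw [h1, h2]⟩

theorem MvN.symm {a : Matrix m m R} {b : Matrix n n R} (h : MvN a b) : MvN b a := by
  obtain ⟨v, h1, h2⟩ := h
  exact ⟨vᴴ, by simpa using h2, by simpa using h1⟩

theorem MvN.trans {a : Matrix k k R} {b : Matrix m m R} {c : Matrix n n R}
    (ha : IsStarProjection a) (hc : IsStarProjection c) (h : MvN a b) (h' : MvN b c) :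
    MvN a c := by
  obtain ⟨v, h1, h2⟩ := h
  obtain ⟨w, h3, h4⟩ := h'
  have ha' : a * a = a := ha.isIdempotentElem
  have hc' : c * c = c := hc.isIdempotentElem
  refine ⟨w * v, ?_, ?_⟩
  · calc (w * v)ᴴ * (w * v) = vᴴ * (wᴴ * w) * v := by
          simp only [Matrix.conjTranspose_mul, Matrix.mul_assoc]
      _ = (vᴴ * v) * (vᴴ * v) := by rw [h3, ← h2]; simp only [Matrix.mul_assoc]
      _ = a := by rw [h1, ha']
  · calc (w * v) * (w * v)ᴴ = w * (v * vᴴ) * wᴴ := by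
          simp only [Matrix.conjTranspose_mul, Matrix.mul_assoc]
      _ = (w * wᴴ) * (w * wᴴ) := by rw [h2, ← h3]; simp only [Matrix.mul_assoc]
      _ = c := by rw [h4, hc']

theorem MvN.submatrix {a : Matrix m m R} (ha : IsStarProjection a) (e : n ≃ m) :
    MvN a (a.submatrix e e) := by
  have h1 : aᴴ = a := ha.isSelfAdjoint
  have h2 : a * a = a := ha.isIdempotentElem
  refine ⟨a.submatrix e id, ?_, ?_⟩
  · rw [Matrix.conjTranspose_submatrix, Matrix.submatrix_mul_equiv, h1, h2, Matrix.submatrix_id_id]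
  · rw [Matrix.conjTranspose_submatrix, ← Matrix.submatrix_mul _ _ _ _ _ Function.bijective_id,
      h1, h2]

theorem MvN.fromBlocks {a : Matrix k k R} {b : Matrix l l R} {c : Matrix m m R}
    {d : Matrix n n R} (h : MvN a c) (h' : MvN b d) :
    MvN (Matrix.fromBlocks a 0 0 b) (Matrix.fromBlocks c 0 0 d) := by
  obtain ⟨v, h1, h2⟩ := h
  obtain ⟨w, h3, h4⟩ := h'
  refine ⟨Matrix.fromBlocks v 0 0 w, ?_, ?_⟩
  · simp [Matrix.fromBlocks_conjTranspose, Matrix.fromBlocks_multiply, h1, h3]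
  · simp [Matrix.fromBlocks_conjTranspose, Matrix.fromBlocks_multiply, h2, h4]

theorem MvN.map {S : Type*} [NonUnitalRing S] [StarRing S] (f : R →⋆ₙ+* S)
    {a : Matrix m m R} {b : Matrix n n R} (h : MvN a b) : MvN (a.map f) (b.map f) := by
  obtain ⟨v, h1, h2⟩ := h
  refine ⟨v.map f, ?_, ?_⟩
  · rw [← Matrix.conjTranspose_map f (fun x => map_star f x), ← Matrix.map_mul, h1]
  · rw [← Matrix.conjTranspose_map f (fun x => map_star f x), ← Matrix.map_mul, h2]

theorem isStarProjection_submatrix {a : Matrix m m R} (ha : IsStarProjection a) (e : n ≃ m) :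
    IsStarProjection (a.submatrix e e) := by
  have h1 : aᴴ = a := ha.isSelfAdjoint
  have h2 : a * a = a := ha.isIdempotentElem
  refine ⟨?_, ?_⟩
  · change a.submatrix e e * a.submatrix e e = _
    rw [Matrix.submatrix_mul_equiv, h2]
  · change (a.submatrix e e)ᴴ = _
    rw [Matrix.conjTranspose_submatrix, h1]

theorem isStarProjection_fromBlocks {a : Matrix m m R} {b : Matrix n n R}
    (ha : IsStarProjection a) (hb : IsStarProjection b) :
    IsStarProjection (Matrix.fromBlocks a 0 0 b) := by
  have h1 : aᴴ = a := ha.isSelfAdjoint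
  have h2 : a * a = a := ha.isIdempotentElem
  have h3 : bᴴ = b := hb.isSelfAdjoint
  have h4 : b * b = b := hb.isIdempotentElem
  refine ⟨?_, ?_⟩
  · change Matrix.fromBlocks a 0 0 b * Matrix.fromBlocks a 0 0 b = _
    simp [Matrix.fromBlocks_multiply, h2, h4]
  · change (Matrix.fromBlocks a 0 0 b)ᴴ = _
    simp [Matrix.fromBlocks_conjTranspose, h1, h3]

end Projections

/-- An element of `P_∞(R)`, the disjoint union of the sets of projections in `M_n(R)`, `n ≥ 1`. -/
structure MatProj (R : Type*) [NonUnitalRing R] [StarRing R] where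
  /-- the size `n` of the matrix -/
  size : ℕ
  size_pos : 0 < size
  /-- the projection in `M_n(R)` -/
  mat : Matrix (Fin size) (Fin size) R
  isProj : IsStarProjection mat

namespace MatProj

variable {R : Type*} [NonUnitalRing R] [StarRing R]

/-- Murray-von Neumann equivalence on `P_∞(R)`. -/
instance setoid (R : Type*) [NonUnitalRing R] [StarRing R] : Setoid (MatProj R) where
  r p q := MvN p.mat q.mat
  iseqv := ⟨fun p => .refl p.isProj, fun h => h.symm,
    fun {p _ r} h h' => h.trans p.isProj r.isProj h'⟩

/-- A projection of `R` as a `1 × 1` matrix. -/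
def single (p : R) (hp : IsStarProjection p) : MatProj R where
  size := 1
  size_pos := Nat.one_pos
  mat := Matrix.of fun _ _ => p
  isProj := by
    have h1 : star p = p := hp.isSelfAdjoint
    have h2 : p * p = p := hp.isIdempotentElem
    refine ⟨?_, ?_⟩
    · ext i j
      simp [Matrix.mul_apply, h2]
    · ext i j
      simp [Matrix.star_apply, h1]

/-- The direct sum `p ⊕ q = diag(p, q)`. -/
def directSum (p q : MatProj R) : MatProj R where
  size := p.size + q.size
  size_pos := Nat.add_pos_left p.size_pos _
  mat := (Matrix.fromBlocks p.mat 0 0 q.mat).submatrix finSumFinEquiv.symm finSumFinEquiv.symm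
  isProj := isStarProjection_submatrix (isStarProjection_fromBlocks p.isProj q.isProj) _

theorem directSum_mvN (p q : MatProj R) :
    MvN (Matrix.fromBlocks p.mat 0 0 q.mat) (p.directSum q).mat :=
  .submatrix (isStarProjection_fromBlocks p.isProj q.isProj) _

theorem directSum_congr {p p' q q' : MatProj R} (h : p ≈ p') (h' : q ≈ q') :
    p.directSum q ≈ p'.directSum q' :=
  have hb := isStarProjection_fromBlocks p.isProj q.isProj
  have hs := (p.directSum q).isProj
  have hs' := (p'.directSum q').isProj
  (directSum_mvN p q).symm.trans hs hs' ((MvN.fromBlocks h h').trans hb hs' (directSum_mvN p' q'))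

theorem directSum_comm (p q : MatProj R) : p.directSum q ≈ q.directSum p := by
  have hb := isStarProjection_fromBlocks p.isProj q.isProj
  have h : MvN (Matrix.fromBlocks p.mat 0 0 q.mat) (Matrix.fromBlocks q.mat 0 0 p.mat) := by
    have := MvN.submatrix hb (Equiv.sumComm (Fin q.size) (Fin p.size))
    simpa using this
  exact (directSum_mvN p q).symm.trans (p.directSum q).isProj (q.directSum p).isProj
    (h.trans hb (q.directSum p).isProj (directSum_mvN q p))

theorem directSum_assoc (p q r : MatProj R) :
    (p.directSum q).directSum r ≈ p.directSum (q.directSum r) := by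
  have hpq := isStarProjection_fromBlocks p.isProj q.isProj
  have hqr := isStarProjection_fromBlocks q.isProj r.isProj
  have h1 := isStarProjection_fromBlocks hpq r.isProj
  have hL := ((p.directSum q).directSum r).isProj
  have hR := (p.directSum (q.directSum r)).isProj
  have e1 : MvN (Matrix.fromBlocks (Matrix.fromBlocks p.mat 0 0 q.mat) 0 0 r.mat)
      ((p.directSum q).directSum r).mat :=
    (MvN.fromBlocks (directSum_mvN p q) (.refl r.isProj)).trans h1 hL (directSum_mvN _ _)
  have e2 : MvN (Matrix.fromBlocks p.mat 0 0 (Matrix.fromBlocks q.mat 0 0 r.mat))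
      (p.directSum (q.directSum r)).mat :=
    (MvN.fromBlocks (.refl p.isProj) (directSum_mvN q r)).trans
      (isStarProjection_fromBlocks p.isProj hqr) hR (directSum_mvN _ _)
  have e3 : MvN (Matrix.fromBlocks (Matrix.fromBlocks p.mat 0 0 q.mat) 0 0 r.mat)
      (Matrix.fromBlocks p.mat 0 0 (Matrix.fromBlocks q.mat 0 0 r.mat)) := by
    have := MvN.submatrix h1 (Equiv.sumAssoc (Fin p.size) (Fin q.size) (Fin r.size)).symm
    convert this using 1
    ext i j
    rcases i with i | i | i <;> rcases j with j | j | j <;> rfl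
  exact e1.symm.trans hL hR (e3.trans h1 hR e2)

theorem zero_directSum (p : MatProj R) : (single (0 : R) (.zero R)).directSum p ≈ p := by
  have h1 : p.matᴴ = p.mat := p.isProj.isSelfAdjoint
  have h2 : p.mat * p.mat = p.mat := p.isProj.isIdempotentElem
  have hz : (single (0 : R) (.zero R)).mat = 0 := rfl
  refine (directSum_mvN _ p).symm.trans (directSum _ p).isProj p.isProj
    ⟨Matrix.fromCols 0 p.mat, ?_, ?_⟩
  · ext i j
    rcases i with i | i <;> rcases j with j | j
    · simp [Matrix.mul_apply, hz]
    · simp [Matrix.mul_apply]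
    · simp [Matrix.mul_apply]
    · have := congrFun (congrFun h2 i) j
      have h1' : ∀ x, star (p.mat x i) = p.mat i x := fun x => congrFun (congrFun h1 i) x
      simpa [Matrix.mul_apply, h1'] using this
  · ext i j
    have := congrFun (congrFun h2 i) j
    have h1' : ∀ x, star (p.mat j x) = p.mat x j := fun x => congrFun (congrFun h1 x) j
    simpa [Matrix.mul_apply, h1'] using this

/-- Entrywise application of a `*`-homomorphism. -/
def map {S : Type*} [NonUnitalRing S] [StarRing S] (f : R →⋆ₙ+* S) (p : MatProj R) :
    MatProj S where
  size := p.size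
  size_pos := p.size_pos
  mat := p.mat.map f
  isProj := by
    have h1 : p.matᴴ = p.mat := p.isProj.isSelfAdjoint
    have h2 : p.mat * p.mat = p.mat := p.isProj.isIdempotentElem
    refine ⟨?_, ?_⟩
    · change p.mat.map f * p.mat.map f = p.mat.map f
      rw [← Matrix.map_mul, h2]
    · change (p.mat.map f)ᴴ = p.mat.map f
      rw [← Matrix.conjTranspose_map f (fun x => map_star f x), h1]

theorem map_congr {S : Type*} [NonUnitalRing S] [StarRing S] (f : R →⋆ₙ+* S)
    {p q : MatProj R} (h : p ≈ q) : p.map f ≈ q.map f :=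
  MvN.map f h

theorem map_directSum {S : Type*} [NonUnitalRing S] [StarRing S] (f : R →⋆ₙ+* S)
    (p q : MatProj R) : (p.directSum q).map f ≈ (p.map f).directSum (q.map f) := by
  have : ((p.directSum q).map f).mat = ((p.map f).directSum (q.map f)).mat := by
    have h : (Matrix.fromBlocks p.mat 0 0 q.mat).map f =
        Matrix.fromBlocks (p.mat.map f) 0 0 (q.mat.map f) := by
      rw [Matrix.fromBlocks_map]
      congr <;> ext <;> simp
    exact congrArg (fun M => Matrix.submatrix M finSumFinEquiv.symm finSumFinEquiv.symm) h
  change MvN _ _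
  rw [this]
  exact .refl ((p.map f).directSum (q.map f)).isProj

theorem equiv_zero_of_mat_eq_zero {p : MatProj R} (h : p.mat = 0) :
    p ≈ single (0 : R) (.zero R) :=
  by
  refine ⟨0, by simp [h], ?_⟩
  rw [Matrix.zero_mul]
  rfl

end MatProj

/-! ### The semigroup of projections and the `K_0`-group -/

/-- `D(R)`: Murray-von Neumann classes of projections in matrix algebras over `R`. -/
def ProjClass (R : Type*) [NonUnitalRing R] [StarRing R] : Type _ := Quotient (MatProj.setoid R)

namespace ProjClass

variable {R : Type*} [NonUnitalRing R] [StarRing R]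

/-- The class of `p` in `D(R)`. -/
def mk (p : MatProj R) : ProjClass R := Quotient.mk _ p

instance : Zero (ProjClass R) := ⟨mk (.single 0 (.zero R))⟩

/-- Addition of classes is induced by the direct sum. -/
instance : Add (ProjClass R) :=
  ⟨Quotient.map₂ MatProj.directSum fun _ _ h _ _ h' => MatProj.directSum_congr h h'⟩

instance : AddCommMonoid (ProjClass R) where
  add_assoc := by rintro ⟨p⟩ ⟨q⟩ ⟨r⟩; exact Quotient.sound (MatProj.directSum_assoc p q r)
  add_comm := by rintro ⟨p⟩ ⟨q⟩; exact Quotient.sound (MatProj.directSum_comm p q)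
  zero_add := by rintro ⟨p⟩; exact Quotient.sound (MatProj.zero_directSum p)
  add_zero := by
    rintro ⟨p⟩
    exact Quotient.sound (Setoid.trans (MatProj.directSum_comm _ _) (MatProj.zero_directSum p))
  nsmul := nsmulRec

/-- The homomorphism `D(R) → D(S)` induced by a `*`-homomorphism `R → S`. -/
def map {S : Type*} [NonUnitalRing S] [StarRing S] (f : R →⋆ₙ+* S) :
    ProjClass R →+ ProjClass S where
  toFun := Quotient.map (MatProj.map f) fun _ _ h => MatProj.map_congr f h
  map_zero' := Quotient.sound (MatProj.equiv_zero_of_mat_eq_zero (by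
    ext i j; exact map_zero f))
  map_add' := by rintro ⟨p⟩ ⟨q⟩; exact Quotient.sound (MatProj.map_directSum f p q)

end ProjClass

/-- The Grothendieck group of `D(R)`; for a unital C⋆-algebra `R` this is `K_0(R)`. -/
abbrev K00 (R : Type*) [NonUnitalRing R] [StarRing R] : Type _ :=
  Algebra.GrothendieckAddGroup (ProjClass R)

/-- The homomorphism `K00 R → K00 S` induced by a `*`-homomorphism `R → S`. -/
noncomputable def K00.map {R S : Type*} [NonUnitalRing R] [StarRing R] [NonUnitalRing S]
    [StarRing S] (f : R →⋆ₙ+* S) : K00 R →+ K00 S :=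
  Algebra.GrothendieckAddGroup.lift (Algebra.GrothendieckAddGroup.of.comp (ProjClass.map f))

section K0

/-- The inclusion of `A` into its unitization `A⁺ = ℂ ⊕ A`. -/
def unitizationInr (A : Type*) [NonUnitalCStarAlgebra A] : A →⋆ₙ+* Unitization ℂ A where
  toFun := Unitization.inr
  map_mul' := Unitization.inr_mul ℂ
  map_zero' := Unitization.inr_zero ℂ
  map_add' := Unitization.inr_add ℂ
  map_star' := Unitization.inr_star

/-- The quotient map from the unitization `A⁺ = ℂ ⊕ A` onto `ℂ`. -/
def unitizationFst (A : Type*) [NonUnitalCStarAlgebra A] : Unitization ℂ A →⋆ₙ+* ℂ where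
  toFun x := x.fst
  map_mul' := Unitization.fst_mul
  map_zero' := Unitization.fst_zero
  map_add' := Unitization.fst_add
  map_star' := Unitization.fst_star

/-- The group `K_0(A)` of a (not necessarily unital) C⋆-algebra: the kernel of
`K_0(A⁺) → K_0(ℂ)`, where `A⁺` is the unitization. -/
def K0 (A : Type*) [NonUnitalCStarAlgebra A] : Type _ := (K00.map (unitizationFst A)).ker

noncomputable instance (A : Type*) [NonUnitalCStarAlgebra A] : AddCommGroup (K0 A) :=
  inferInstanceAs (AddCommGroup (K00.map (unitizationFst A)).ker)

/-- The canonical homomorphism `D(A) → K_0(A)`. -/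
noncomputable def K0.ofProjClass (A : Type*) [NonUnitalCStarAlgebra A] : ProjClass A →+ K0 A :=
  AddMonoidHom.codRestrict
    ((Algebra.GrothendieckAddGroup.of (M := ProjClass (Unitization ℂ A))).comp
      (ProjClass.map (unitizationInr A)))
    (K00.map (unitizationFst A)).ker (by
      rintro ⟨p⟩
      have h0 : ProjClass.map (unitizationFst A) (ProjClass.map (unitizationInr A)
          (ProjClass.mk p)) = 0 :=
        Quotient.sound (MatProj.equiv_zero_of_mat_eq_zero (by
          ext i j; exact Unitization.fst_inr ℂ (p.mat i j)))
      have h1 : ∀ x, K00.map (unitizationFst A) (Algebra.GrothendieckAddGroup.of x) =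
          Algebra.GrothendieckAddGroup.of (ProjClass.map (unitizationFst A) x) := fun x =>
        DFunLike.congr_fun (Algebra.GrothendieckAddGroup.lift.symm_apply_apply
          (Algebra.GrothendieckAddGroup.of.comp (ProjClass.map (unitizationFst A)))) x
      rw [AddMonoidHom.mem_ker]
      exact (h1 _).trans ((congrArg _ h0).trans (map_zero _)))

variable {A : Type*} [NonUnitalCStarAlgebra A]

/-- The class `[p]_0` in `K_0(A)` of a projection `p` in a matrix algebra over `A`. -/
noncomputable def K0.mk (p : MatProj A) : K0 A := K0.ofProjClass A (ProjClass.mk p)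

/-- The class `[p]_0` in `K_0(A)` of a projection `p` in `A`. -/
noncomputable def K0.cls (p : A) (hp : IsStarProjection p) : K0 A := K0.mk (.single p hp)

/-- The positive cone `K_0(A)⁺ = {[p]_0 | p ∈ P_∞(A)}`. -/
noncomputable def K0Pos (A : Type*) [NonUnitalCStarAlgebra A] : AddSubmonoid (K0 A) where
  carrier := Set.range K0.mk
  zero_mem' := ⟨.single 0 (.zero A), map_zero (K0.ofProjClass A)⟩
  add_mem' := by
    rintro _ _ ⟨p, rfl⟩ ⟨q, rfl⟩
    exact ⟨p.directSum q, map_add (K0.ofProjClass A) (ProjClass.mk p) (ProjClass.mk q)⟩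

/-- The (pre)order of `K_0(A)`: `g ≤ h` if and only if `h - g ∈ K_0(A)⁺`. -/
noncomputable instance (A : Type*) [NonUnitalCStarAlgebra A] : Preorder (K0 A) where
  le g h := h - g ∈ K0Pos A
  le_refl g := by simp
  le_trans f g h h1 h2 := by
    have := add_mem h1 h2
    rwa [sub_add_sub_comm, add_comm g h, add_sub_add_right_eq_sub] at this

/-- The dimension range `D_0(A) = {[p]_0 | p ∈ P(A)}`. -/
def dimensionRange (A : Type*) [NonUnitalCStarAlgebra A] : Set (K0 A) :=
  {g | ∃ (p : A) (hp : IsStarProjection p), K0.cls p hp = g}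

/-- The cancellation property. -/
def HasCancellation (A : Type*) [NonUnitalCStarAlgebra A] : Prop :=
  ∀ p q : MatProj A, K0.mk p = K0.mk q ↔ MvN p.mat q.mat

/-- `A`, embedded in its multiplier algebra `M(A)`, lies in the norm closure of the set of
invertible elements of `M(A)`. -/
def InClosureOfInvertibleMultipliers (A : Type*) [NonUnitalCStarAlgebra A] : Prop :=
  ∀ a : A, (a : 𝓜(ℂ, A)) ∈ closure {x : 𝓜(ℂ, A) | IsUnit x}

/-- The singular value function
`s_g(a) = inf {‖a - a p‖ | p ∈ P(A), [p]_0 ≤ g}`, for `g ∈ K_0(A)⁺`. -/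
noncomputable def singularValue (a : A) (g : K0Pos A) : ℝ :=
  sInf {x : ℝ | ∃ (p : A) (hp : IsStarProjection p), K0.cls p hp ≤ (g : K0 A) ∧ x = ‖a - a * p‖}

/-- The infimum defining `s_g(a)` is over a nonempty set which is bounded below by `0`. -/
theorem singularValue_isGLB (a : A) (g : K0Pos A) :
    IsGLB {x : ℝ | ∃ (p : A) (hp : IsStarProjection p),
      K0.cls p hp ≤ (g : K0 A) ∧ x = ‖a - a * p‖} (singularValue a g) := by
  refine isGLB_csInf ⟨‖a - a * 0‖, 0, .zero A, ?_, rfl⟩ ⟨0, ?_⟩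
  · have h : K0.cls (0 : A) (.zero A) = 0 := map_zero (K0.ofProjClass A)
    rw [h]
    change (g : K0 A) - 0 ∈ K0Pos A
    simp
  · rintro _ ⟨p, hp, -, rfl⟩
    exact norm_nonneg _

end K0

end SVF

/-!
The singular value `s_g(a)` is the distance from `a` to elements of the form `a p` with
`[p]₀ ≤ g`. If `p`, `q` are nearly optimal for `a` and `b`, then `a + b` is close to
`x = a p + b q`, so it suffices to approximate `x` by `x r` with a projection `r` such that
`[r]₀ = [p]₀ + [q]₀`.

The cone being equal to the dimension range, `[p]₀ + [q]₀ = [e]₀` for a projection `e` of `A`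
itself, and cancellation turns this into an equivalence of `e` with `diag(p, q)` through a column
`(v₁, v₂)` (`exists_column_of_mvN_directSum`). It follows that `p = v₁ w` and `q = v₂ w` for
`w = v₁⋆ + v₂⋆`, hence `x = c w` with `c = a v₁ + b v₂` and `e w = w`: the element `x` factors
through the single projection `e`.

The element `w` need not have a right support projection in `A`. If `m` is an invertible multiplier
close to `w`, however, then `e m m⋆ e` is invertible in the corner of `e`, so `e m` has a polar
decomposition `e m = |(e m)⋆| u` with `u u⋆ = e` and `u⋆ u` fixing `e m` from the right
(`exists_polar_of_isUnit`). The projection `r = u⋆ u` lies in `A`, because `A` is an ideal of its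
multiplier algebra; it is equivalent to `e`, and `w - w r` is as small as `w - e m`
(`exists_equiv_projection_norm_sub_mul_lt`).
-/

namespace SVF

/-! ### Projections and invertible elements in C⋆-algebras -/

open DoubleCentralizer in
/-- The embedding of `A` into its multiplier algebra is isometric, being an injective
`*`-homomorphism of C⋆-algebras. -/
theorem norm_coeHom {A : Type*} [NonUnitalCStarAlgebra A] (a : A) :
    ‖(coeHom a : 𝓜(ℂ, A))‖ = ‖a‖ := by
  refine NonUnitalStarAlgHom.norm_map (coeHom : A →⋆ₙₐ[ℂ] 𝓜(ℂ, A)) ?_ a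
  refine (injective_iff_map_eq_zero _).2 fun x hx => ?_
  have h : (coeHom x : 𝓜(ℂ, A)).fst (star x) = 0 := by rw [hx]; simp
  exact CStarRing.mul_star_self_eq_zero_iff x |>.1 h

/-- The inequality `‖z (1 - r)‖ ≤ ‖z‖` in a possibly non-unital C⋆-algebra. -/
theorem norm_sub_mul_le_of_isStarProjection {A : Type*} [NonUnitalCStarAlgebra A] (z : A) {r : A}
    (hr : IsStarProjection r) : ‖z - z * r‖ ≤ ‖z‖ := by
  let j := (DoubleCentralizer.coeHom : A →⋆ₙₐ[ℂ] 𝓜(ℂ, A))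
  have hp : ‖1 - j r‖ ≤ 1 := (hr.map j).one_sub.norm_le
  calc ‖z - z * r‖ = ‖j z * (1 - j r)‖ := by
        rw [← norm_coeHom, map_sub, map_mul, mul_sub, mul_one]
    _ ≤ ‖j z‖ * ‖1 - j r‖ := norm_mul_le _ _
    _ ≤ ‖j z‖ := mul_le_of_le_one_right (norm_nonneg _) hp
    _ = ‖z‖ := norm_coeHom z

/-- A partial isometry is fixed from the left by its range projection. -/
theorem mul_eq_self_of_mul_star_self_eq {A : Type*} [NonUnitalCStarAlgebra A] {e u : A}
    (he : IsStarProjection e) (hu : u * star u = e) : e * u = u := by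
  have hee : e * e = e := he.isIdempotentElem
  rw [← sub_eq_zero, ← CStarRing.mul_star_self_eq_zero_iff]
  calc (e * u - u) * star (e * u - u)
      = e * (u * star u) * e - e * (u * star u) - (u * star u) * e + u * star u := by
        simp only [star_sub, star_mul, he.isSelfAdjoint.star_eq, sub_mul, mul_sub, mul_assoc]
        abel
    _ = 0 := by simp [hu, hee]

/-- Polar decomposition of the compression `e m` of an invertible element `m` by a projection
`e`: since `e m m⋆ e` is invertible in the corner of `e`, the partial isometry `u` has the form
`s e m` and its range projection is all of `e`. -/
theorem exists_polar_of_isUnit {B : Type*} [CStarAlgebra B] {e m : B} (he : IsStarProjection e)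
    (hm : IsUnit m) :
    ∃ s : B, (s * (e * m)) * star (s * (e * m)) = e ∧
      (e * m) * (star (s * (e * m)) * (s * (e * m))) = e * m := by
  cases subsingleton_or_nontrivial B
  · exact ⟨0, Subsingleton.elim _ _, Subsingleton.elim _ _⟩
  let _ := CStarAlgebra.spectralOrder B
  let _ := CStarAlgebra.spectralOrderedRing B
  have hee : e * e = e := he.isIdempotentElem
  have hes : star e = e := he.isSelfAdjoint
  -- Adding `1 - e` makes `e m m⋆ e` invertible in the whole algebra.
  set t : B := e * (m * star m) * e + (1 - e) with ht
  have hpos : IsStrictlyPositive (m * star m) :=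
    (hm.mul hm.star).isStrictlyPositive (mul_star_self_nonneg m)
  have htpos : IsStrictlyPositive t := by
    obtain ⟨r, hr, hle⟩ : ∃ r > 0, algebraMap ℝ B r ≤ m * star m :=
      (CFC.exists_pos_algebraMap_le_iff hpos.isSelfAdjoint).2 fun x hx => hpos.spectrum_pos hx
    have hle' : r • e ≤ e * (m * star m) * e := by
      have := star_left_conjugate_le_conjugate hle e
      rw [hes] at this
      simpa [Algebra.algebraMap_eq_smul_one, hee] using this
    refine IsStrictlyPositive.of_le (a := r • e + (1 - e)) ?_ (by rw [ht]; gcongr)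
    refine IsUnit.isStrictlyPositive ?_
      (add_nonneg (smul_nonneg hr.le he.nonneg) he.one_sub_nonneg)
    have key : ∀ a b : ℝ, a * b = 1 → (a • e + (1 - e)) * (b • e + (1 - e)) = 1 := by
      intro a b hab
      have h1 : e * (1 - e) = 0 := he.mul_one_sub_self
      have h2 : (1 - e) * e = 0 := he.one_sub_mul_self
      have h3 : (1 - e) * (1 - e) = 1 - e := he.one_sub.isIdempotentElem
      simp [add_mul, mul_add, smul_smul, mul_comm b a, hee, h1, h2, h3, hab]
    exact ⟨⟨_, _, key r r⁻¹ (mul_inv_cancel₀ hr.ne'), key r⁻¹ r (inv_mul_cancel₀ hr.ne')⟩, rfl⟩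
  have hte : t * e = e * (m * star m) * e := by
    rw [ht, add_mul, he.one_sub_mul_self, add_zero, mul_assoc _ e e, hee]
  have het : e * t = e * (m * star m) * e := by
    rw [ht, mul_add, he.mul_one_sub_self, add_zero, ← mul_assoc, ← mul_assoc, hee]
  set s : B := t ^ (-(1 / 2) : ℝ) with hs
  have hst : s * t * s = 1 := CFC.conjugate_rpow_neg_one_half t
  have hss : star s = s := (IsSelfAdjoint.of_nonneg CFC.rpow_nonneg).star_eq
  have hse : Commute s e := by
    have h : Commute t e := hte.trans het.symm
    exact h.cfc_nnreal _
  have hsts : Commute s t := (Commute.refl t).cfc_nnreal _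
  have hstar : star (s * (e * m)) = star m * e * s := by
    simp only [star_mul, hss, hes]
  refine ⟨s, ?_, ?_⟩
  · calc s * (e * m) * star (s * (e * m)) = s * (e * (m * star m) * e) * s := by
          rw [hstar]; simp only [mul_assoc]
      _ = s * t * (e * s) := by rw [← hte]; simp only [mul_assoc]
      _ = s * t * s * e := by rw [← hse.eq, ← mul_assoc]
      _ = e := by rw [hst, one_mul]
  · calc e * m * (star (s * (e * m)) * (s * (e * m))) = e * (m * star m) * e * (s * s * e * m) := by
          rw [hstar]; simp only [mul_assoc]
      _ = e * (t * s * s) * e * m := by rw [← het]; simp only [mul_assoc]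
      _ = e * m := by rw [← hsts.eq, hst, mul_one, hee]

open DoubleCentralizer in
/-- If `e w = w`, then `w` is almost fixed from the right by a projection `u⋆ u` equivalent
to `e`. -/
theorem exists_equiv_projection_norm_sub_mul_lt {A : Type*} [NonUnitalCStarAlgebra A]
    (hclosure : InClosureOfInvertibleMultipliers A) {e w : A} (he : IsStarProjection e)
    (hw : e * w = w) {ε : ℝ} (hε : 0 < ε) :
    ∃ u : A, u * star u = e ∧ IsStarProjection (star u * u) ∧ ‖w - w * (star u * u)‖ < ε := by
  let j := (coeHom : A →⋆ₙₐ[ℂ] 𝓜(ℂ, A))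
  have hinj : Function.Injective j :=
    (AddMonoidHomClass.isometry_of_norm j norm_coeHom).injective
  obtain ⟨m, hm : IsUnit m, hmw⟩ := Metric.mem_closure_iff.1 (hclosure w) ε hε
  have hmw' : ‖j w - m‖ < ε := by rw [← dist_eq_norm]; exact hmw
  have hje : IsStarProjection (j e) := he.map j
  obtain ⟨s, hs1, hs2⟩ := exists_polar_of_isUnit hje hm
  -- The partial isometry lies in `A`, an ideal of the multiplier algebra.
  have hleft : ∀ (x : 𝓜(ℂ, A)) (a : A), x * j a = j (x.fst a) := by
    intro x a
    rw [← sub_eq_zero, ← norm_eq_zero, ← norm_snd, norm_eq_zero]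
    ext b
    change x.snd b * a - b * x.fst a = 0
    rw [x.central, sub_self]
  have hright : ∀ (x : 𝓜(ℂ, A)) (a : A), j a * x = j (x.snd a) := by
    intro x a
    rw [← sub_eq_zero, ← norm_eq_zero, ← norm_fst, norm_eq_zero]
    ext b
    change a * x.fst b - x.snd a * b = 0
    rw [x.central, sub_self]
  obtain ⟨u, hu⟩ : ∃ u : A, j u = s * (j e * m) := ⟨_, by rw [hright, hleft]⟩
  rw [← hu] at hs1 hs2
  have hue : u * star u = e := hinj (by rw [map_mul, map_star, hs1])
  have heu : e * u = u := mul_eq_self_of_mul_star_self_eq he hue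
  have hr : IsStarProjection (star u * u) := by
    refine ⟨?_, .star_mul_self u⟩
    change star u * u * (star u * u) = _
    rw [mul_assoc, ← mul_assoc u, hue, heu]
  refine ⟨u, hue, hr, ?_⟩
  have hp : ‖1 - j (star u * u)‖ ≤ 1 := (hr.map j).one_sub.norm_le
  calc ‖w - w * (star u * u)‖ = ‖j e * (j w - m) * (1 - j (star u * u))‖ := by
        rw [← norm_coeHom]
        congr 1
        have h1 : j e * (j w - m) = j w - j e * m := by rw [mul_sub, ← map_mul, hw]
        have h2 : j e * m * j (star u * u) = j e * m := by rw [map_mul, map_star, hs2]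
        rw [h1, mul_sub, mul_one, sub_mul, h2, map_sub, map_mul]
        abel
    _ ≤ ‖j e‖ * ‖j w - m‖ * ‖1 - j (star u * u)‖ := norm_mul₃_le
    _ ≤ 1 * ‖j w - m‖ * 1 := by gcongr; exact hje.norm_le
    _ < ε := by simpa using hmw'

/-! ### Sums of projections and the inequality -/

/-- Equivalent projections of `A` have the same class in `K₀(A)`. -/
theorem K0.cls_eq_of_star_mul_self {A : Type*} [NonUnitalCStarAlgebra A] {e r u : A}
    (he : IsStarProjection e) (hr : IsStarProjection r) (hue : u * star u = e)
    (hur : star u * u = r) : K0.cls r hr = K0.cls e he := by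
  refine congrArg (K0.ofProjClass A) (Quotient.sound ?_)
  change MvN (Matrix.of fun _ _ : Fin 1 => r) (Matrix.of fun _ _ : Fin 1 => e)
  refine ⟨Matrix.of fun _ _ => u, ?_, ?_⟩
  · ext i j
    simpa [Matrix.mul_apply] using hur
  · ext i j
    simpa [Matrix.mul_apply] using hue

/-- An equivalence of `e` with `diag(p, q)` is a column `(v₁, v₂)`; the entries satisfy the relations
`v vᴴ = diag(p, q)` and `vᴴ v = e`. -/
theorem exists_column_of_mvN_directSum {R : Type*} [NonUnitalRing R] [StarRing R] {e p q : R}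
    (he : IsStarProjection e) (hp : IsStarProjection p) (hq : IsStarProjection q)
    (h : MatProj.single e he ≈ (MatProj.single p hp).directSum (MatProj.single q hq)) :
    ∃ v₁ v₂ : R, star v₁ * v₁ + star v₂ * v₂ = e ∧ v₁ * star v₁ = p ∧ v₂ * star v₂ = q ∧
      v₁ * star v₂ = 0 ∧ v₂ * star v₁ = 0 := by
  obtain ⟨v, h1, h2⟩ : MvN (Matrix.of fun _ _ : Fin 1 => e)
      (Matrix.fromBlocks (Matrix.of fun _ _ : Fin 1 => p) 0 0 (Matrix.of fun _ _ : Fin 1 => q)) :=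
    MvN.trans (MatProj.single e he).isProj
      (isStarProjection_fromBlocks (MatProj.single p hp).isProj (MatProj.single q hq).isProj) h
      (MatProj.directSum_mvN _ _).symm
  have h2' := fun i j => congrFun (congrFun h2 i) j
  refine ⟨v (.inl 0) 0, v (.inr 0) 0, ?_, ?_, ?_, ?_, ?_⟩
  · have := congrFun (congrFun h1 0) 0
    simpa [Matrix.mul_apply] using this
  · simpa [Matrix.mul_apply] using h2' (.inl 0) (.inl 0)
  · simpa [Matrix.mul_apply] using h2' (.inr 0) (.inr 0)
  · simpa [Matrix.mul_apply] using h2' (.inl 0) (.inr 0)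
  · simpa [Matrix.mul_apply] using h2' (.inr 0) (.inl 0)

/-- The element `a p + b q` is almost fixed from the right by a projection of class
`[p]₀ + [q]₀`. -/
theorem exists_projection_cls_eq_add {A : Type*} [NonUnitalCStarAlgebra A]
    (hcancel : HasCancellation A) (hclosure : InClosureOfInvertibleMultipliers A)
    (hD : (K0Pos A : Set (K0 A)) = dimensionRange A) (a b : A) {p q : A}
    (hp : IsStarProjection p) (hq : IsStarProjection q) {ε : ℝ} (hε : 0 < ε) :
    ∃ (r : A) (hr : IsStarProjection r), K0.cls r hr = K0.cls p hp + K0.cls q hq ∧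
      ‖(a * p + b * q) - (a * p + b * q) * r‖ < ε := by
  have hsum : K0.mk ((MatProj.single p hp).directSum (MatProj.single q hq)) =
      K0.cls p hp + K0.cls q hq :=
    map_add (K0.ofProjClass A) (ProjClass.mk (MatProj.single p hp))
      (ProjClass.mk (MatProj.single q hq))
  obtain ⟨e, he, hecls⟩ : K0.cls p hp + K0.cls q hq ∈ dimensionRange A := by
    rw [← hD, ← hsum]
    exact ⟨_, rfl⟩
  obtain ⟨v₁, v₂, h1, h2, h3, h4, h5⟩ :=
    exists_column_of_mvN_directSum he hp hq ((hcancel _ _).1 (hecls.trans hsum.symm))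
  set w : A := star v₁ + star v₂ with hw
  set c : A := a * v₁ + b * v₂ with hc
  have hw1 : v₁ * w = p := by rw [hw, mul_add, h2, h4, add_zero]
  have hw2 : v₂ * w = q := by rw [hw, mul_add, h3, h5, zero_add]
  have hcw : a * p + b * q = c * w := by
    rw [hc, add_mul, mul_assoc, mul_assoc, hw1, hw2]
  -- `v₁ = p v₁` because `v₁ v₁⋆` is a projection, and likewise for `v₂`.
  have hew : e * w = w := by
    have e1 : star v₁ * p = star v₁ := by
      simpa [hp.isSelfAdjoint.star_eq] using
        congrArg star (mul_eq_self_of_mul_star_self_eq hp h2)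
    have e2 : star v₂ * q = star v₂ := by
      simpa [hq.isSelfAdjoint.star_eq] using
        congrArg star (mul_eq_self_of_mul_star_self_eq hq h3)
    rw [← h1, add_mul, mul_assoc, mul_assoc, hw1, hw2, e1, e2]
  obtain ⟨u, hue, hr, hu⟩ := exists_equiv_projection_norm_sub_mul_lt hclosure he hew
    (div_pos hε (by positivity : 0 < ‖c‖ + 1))
  refine ⟨star u * u, hr, (K0.cls_eq_of_star_mul_self he hr hue rfl).trans hecls, ?_⟩
  calc ‖a * p + b * q - (a * p + b * q) * (star u * u)‖ = ‖c * (w - w * (star u * u))‖ := by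
        rw [hcw, mul_sub, mul_assoc]
    _ ≤ ‖c‖ * ‖w - w * (star u * u)‖ := norm_mul_le _ _
    _ ≤ (‖c‖ + 1) * ‖w - w * (star u * u)‖ := by gcongr; linarith
    _ < (‖c‖ + 1) * (ε / (‖c‖ + 1)) := by gcongr
    _ = ε := by field_simp

end SVF

theorem mainTheorem1 {A : Type*} [NonUnitalCStarAlgebra A]
    (hcancel : SVF.HasCancellation A)
    (hclosure : SVF.InClosureOfInvertibleMultipliers A)
    (hD : (SVF.K0Pos A : Set (SVF.K0 A)) = SVF.dimensionRange A)
    (a b : A) (g h : SVF.K0Pos A) :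
    SVF.singularValue (a + b) (g + h) ≤ SVF.singularValue a g + SVF.singularValue b h := by
  refine le_of_forall_pos_le_add fun ε hε => ?_
  obtain ⟨_, ⟨p, hp, hpg, rfl⟩, -, hpa⟩ :=
    (SVF.singularValue_isGLB a g).exists_between (lt_add_of_pos_right _ (by positivity : 0 < ε / 3))
  obtain ⟨_, ⟨q, hq, hqh, rfl⟩, -, hqb⟩ :=
    (SVF.singularValue_isGLB b h).exists_between (lt_add_of_pos_right _ (by positivity : 0 < ε / 3))
  obtain ⟨r, hr, hrcls, hrn⟩ := SVF.exists_projection_cls_eq_add hcancel hclosure hD a b hp hq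
    (by positivity : 0 < ε / 3)
  have hle : SVF.K0.cls r hr ≤ ((g + h : SVF.K0Pos A) : SVF.K0 A) := by
    rw [hrcls]
    change ((g : SVF.K0 A) + h) - _ ∈ SVF.K0Pos A
    rw [add_sub_add_comm]
    exact add_mem hpg hqh
  have hnorm : ‖(a + b) - (a + b) * r‖ ≤ ‖a - a * p‖ + ‖b - b * q‖ +
      ‖(a * p + b * q) - (a * p + b * q) * r‖ := by
    set x := a * p + b * q with hx
    set z := (a - a * p) + (b - b * q) with hz
    have hab : a + b = z + x := by rw [hx, hz]; abel
    calc ‖(a + b) - (a + b) * r‖ = ‖(z - z * r) + (x - x * r)‖ := by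
          rw [hab, add_mul, add_sub_add_comm]
      _ ≤ ‖z - z * r‖ + ‖x - x * r‖ := norm_add_le _ _
      _ ≤ ‖a - a * p‖ + ‖b - b * q‖ + ‖x - x * r‖ := by
          gcongr
          exact (SVF.norm_sub_mul_le_of_isStarProjection z hr).trans (norm_add_le _ _)
  have := (SVF.singularValue_isGLB (a + b) (g + h)).1 ⟨r, hr, hle, rfl⟩
  linarith
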